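/- Let $m\ge 1$ be an integer and $q$ a real number with $-1<q<1$ if $m=1$ and $\frac{1}{1-m}<q<1$ if $m>1$. Let $\mathbf{A}$ be the deformed quon algebra at $q$: the unital associative real algebra generated by elements $a_{i,k}$ and $a_{i,k}^{\dagger}$, for $i\in\{1,2,3,\dots\}$ and $k\in\{1,\dots,m\}$, subject to the relations $$a_{j,l}\,a_{i,k}^{\dagger}=q\,a_{i,k}^{\dagger}\,a_{j,l}+q^{\beta_{-k,l}}\,\delta_{i,j},\qquad \beta_{-k,l}=\begin{cases}0&\text{if } l-k\equiv m \pmod m,\\ 1&\text{otherwise,}\end{cases}$$ (with $q^0=1$ also for $q=0$), and let $x\mapsto x^{\dagger}$ be the real-linear anti-involution of $\mathbf{A}$ that exchanges $a_{i,k}$ and $a_{i,k}^{\dagger}$. Then the following hold. 1. There is exactly one linear functional $x\mapsto\langle 0|x|0\rangle$ on $\mathbf{A}$ (the vacuum expectation) with $\langle 0|1|0\rangle=1$ and $\langle 0|x\,a_{i,k}|0\rangle=0=\langle 0|a_{i,k}^{\dagger}\,x|0\rangle$ for all $x\in\mathbf{A}$ and all $(i,k)$. 2. There is a Fock-like representation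 of $\mathbf{A}$, that is, a representation of $\mathbf{A}$ by linear operators on a real vector space $\mathbf{V}$ with a nonzero vector $|0\rangle\in\mathbf{V}$ such that $a_{i,k}|0\rangle=0$ for all $(i,k)$. 3. For every Fock-like representation, let $\mathbf{H}=\{x|0\rangle : x\in\mathbf{A}\}\subseteq\mathbf{V}$. Then $$\big(x|0\rangle,\,y|0\rangle\big):=\langle 0|x^{\dagger}y|0\rangle\qquad(x,y\in\mathbf{A})$$ is a well-defined bilinear form on $\mathbf{H}$, and it is symmetric and positive definite. So $\mathbf{H}$ is a pre-Hilbert space for this form: it embeds linearly, isometrically and densely in a real Hilbert space. -/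

import Mathlib

universe u

namespace Quon

/-- The exponent `β_{-k,l}`: it is `0` if `l - k ≡ m (mod m)` and `1` otherwise.  The colours
`1, …, m` are represented by `Fin m`; only differences of colours matter. -/
def beta {m : ℕ} (k l : Fin m) : ℕ :=
  if ((l : ℕ) : ℤ) - ((k : ℕ) : ℤ) ≡ (m : ℤ) [ZMOD (m : ℤ)] then 0 else 1

theorem beta_comm {m : ℕ} (k l : Fin m) : beta k l = beta l k := by
  have h : ∀ k l : Fin m, ((l : ℕ) : ℤ) - ((k : ℕ) : ℤ) ≡ (m : ℤ) [ZMOD (m : ℤ)] →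
      ((k : ℕ) : ℤ) - ((l : ℕ) : ℤ) ≡ (m : ℤ) [ZMOD (m : ℤ)] := by
    intro k l h
    rw [Int.modEq_iff_dvd] at h ⊢
    obtain ⟨c, hc⟩ := h
    exact ⟨2 - c, by linarith⟩
  unfold beta
  by_cases h1 : ((l : ℕ) : ℤ) - ((k : ℕ) : ℤ) ≡ (m : ℤ) [ZMOD (m : ℤ)]
  · rw [if_pos h1, if_pos (h k l h1)]
  · rw [if_neg h1, if_neg (fun h2 => h1 (h l k h2))]

/-- The generators `a_{i,k}` (`ann i k`) and `a_{i,k}^†` (`cre i k`). -/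
inductive Gen (m : ℕ) : Type
  | ann (i : ℕ+) (k : Fin m) : Gen m
  | cre (i : ℕ+) (k : Fin m) : Gen m

/-- The relations `a_{j,l} a_{i,k}^† = q a_{i,k}^† a_{j,l} + q^{β_{-k,l}} δ_{i,j}`. -/
inductive Rel (q : ℝ) (m : ℕ) : FreeAlgebra ℝ (Gen m) → FreeAlgebra ℝ (Gen m) → Prop
  | comm (j : ℕ+) (l : Fin m) (i : ℕ+) (k : Fin m) :
      Rel q m
        (FreeAlgebra.ι ℝ (Gen.ann j l) * FreeAlgebra.ι ℝ (Gen.cre i k))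
        (q • (FreeAlgebra.ι ℝ (Gen.cre i k) * FreeAlgebra.ι ℝ (Gen.ann j l))
          + (q ^ beta k l * (if i = j then 1 else 0)) • 1)

/-- The deformed quon algebra at the real parameter `q`, with `m` colours. -/
def Alg (q : ℝ) (m : ℕ) : Type := RingQuot (Rel q m)

noncomputable instance (q : ℝ) (m : ℕ) : Ring (Alg q m) :=
  inferInstanceAs (Ring (RingQuot (Rel q m)))

noncomputable instance (q : ℝ) (m : ℕ) : Algebra ℝ (Alg q m) :=
  inferInstanceAs (Algebra ℝ (RingQuot (Rel q m)))

/-- The quotient map from the free algebra. -/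
noncomputable def mk (q : ℝ) (m : ℕ) : FreeAlgebra ℝ (Gen m) →ₐ[ℝ] Alg q m :=
  RingQuot.mkAlgHom ℝ (Rel q m)

/-- The annihilation element `a_{i,k}`. -/
noncomputable def a (q : ℝ) {m : ℕ} (i : ℕ+) (k : Fin m) : Alg q m :=
  mk q m (FreeAlgebra.ι ℝ (Gen.ann i k))

/-- The creation element `a_{i,k}^†`. -/
noncomputable def aDag (q : ℝ) {m : ℕ} (i : ℕ+) (k : Fin m) : Alg q m :=
  mk q m (FreeAlgebra.ι ℝ (Gen.cre i k))

theorem a_mul_aDag (q : ℝ) {m : ℕ} (j : ℕ+) (l : Fin m) (i : ℕ+) (k : Fin m) :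
    a q j l * aDag q i k =
      q • (aDag q i k * a q j l) + (q ^ beta k l * (if i = j then 1 else 0)) • (1 : Alg q m) := by
  have h := RingQuot.mkAlgHom_rel ℝ (Rel.comm (q := q) (m := m) j l i k)
  change mk q m _ = mk q m _ at h
  simp only [map_mul, map_add, map_smul, map_one] at h
  exact h

/-- The lift of `a ↦ a^†` as a homomorphism to the opposite algebra. -/
noncomputable def daggerHom (q : ℝ) (m : ℕ) : Alg q m →ₐ[ℝ] (Alg q m)ᵐᵒᵖ :=
  RingQuot.liftAlgHom ℝ
    ⟨FreeAlgebra.lift ℝ (fun g : Gen m => match g with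
        | Gen.ann i k => MulOpposite.op (aDag q i k)
        | Gen.cre i k => MulOpposite.op (a q i k)), by
      intro x y h
      cases h with
      | comm j l i k =>
        simp only [map_mul, map_add, map_smul, map_one, FreeAlgebra.lift_ι_apply]
        apply MulOpposite.unop_injective
        simp only [MulOpposite.unop_mul, MulOpposite.unop_op, MulOpposite.unop_add,
          MulOpposite.unop_smul, MulOpposite.unop_one]
        rw [a_mul_aDag, beta_comm]
        simp only [eq_comm]⟩

theorem daggerHom_a (q : ℝ) {m : ℕ} (i : ℕ+) (k : Fin m) :
    daggerHom q m (a q i k) = MulOpposite.op (aDag q i k) := by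
  unfold daggerHom a mk
  erw [RingQuot.liftAlgHom_mkAlgHom_apply]
  simp

theorem daggerHom_aDag (q : ℝ) {m : ℕ} (i : ℕ+) (k : Fin m) :
    daggerHom q m (aDag q i k) = MulOpposite.op (a q i k) := by
  unfold daggerHom aDag mk
  erw [RingQuot.liftAlgHom_mkAlgHom_apply]
  simp

/-- Two algebra homomorphisms that agree on all generators are equal. -/
theorem algHom_ext {q : ℝ} {m : ℕ} {B : Type*} [Ring B] [Algebra ℝ B] {f g : Alg q m →ₐ[ℝ] B}
    (h1 : ∀ i k, f (a q i k) = g (a q i k)) (h2 : ∀ i k, f (aDag q i k) = g (aDag q i k)) :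
    f = g := by
  apply RingQuot.ringQuot_ext'
  apply FreeAlgebra.hom_ext
  funext x
  cases x with
  | ann i k => exact h1 i k
  | cre i k => exact h2 i k

theorem unop_daggerHom_daggerHom {q : ℝ} {m : ℕ} (x : Alg q m) :
    (daggerHom q m (daggerHom q m x).unop).unop = x := by
  have h : ((AlgHom.opComm (daggerHom q m)).comp (daggerHom q m)) = AlgHom.id ℝ (Alg q m) := by
    apply algHom_ext
    · intro i k
      change (daggerHom q m (daggerHom q m (a q i k)).unop).unop = a q i k
      rw [daggerHom_a, MulOpposite.unop_op, daggerHom_aDag, MulOpposite.unop_op]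
    · intro i k
      change (daggerHom q m (daggerHom q m (aDag q i k)).unop).unop = aDag q i k
      rw [daggerHom_aDag, MulOpposite.unop_op, daggerHom_a, MulOpposite.unop_op]
  exact DFunLike.congr_fun h x

/-- The anti-involution `†` of the deformed quon algebra, written `star`: it is `ℝ`-linear,
reverses products and exchanges `a_{i,k}` with `a_{i,k}^†`. -/
noncomputable instance (q : ℝ) (m : ℕ) : StarRing (Alg q m) where
  star x := (daggerHom q m x).unop
  star_involutive := unop_daggerHom_daggerHom
  star_mul x y := by
    change (daggerHom q m (x * y)).unop = (daggerHom q m y).unop * (daggerHom q m x).unop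
    rw [map_mul, MulOpposite.unop_mul]
  star_add x y := by
    change (daggerHom q m (x + y)).unop = (daggerHom q m x).unop + (daggerHom q m y).unop
    rw [map_add, MulOpposite.unop_add]

instance (q : ℝ) (m : ℕ) : StarModule ℝ (Alg q m) where
  star_smul r x := by
    change (daggerHom q m (r • x)).unop = r • (daggerHom q m x).unop
    rw [map_smul, MulOpposite.unop_smul]

theorem star_a (q : ℝ) {m : ℕ} (i : ℕ+) (k : Fin m) : star (a q i k) = aDag q i k := by
  change (daggerHom q m (a q i k)).unop = aDag q i k
  rw [daggerHom_a, MulOpposite.unop_op]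

/-- `ω x` is the vacuum expectation `⟨0| x |0⟩`: the linear functional determined by
`⟨0|0⟩ = 1`, `a_{i,k} |0⟩ = 0` and `⟨0| a_{i,k}^† = 0`. -/
structure IsVacuumExpectation {q : ℝ} {m : ℕ} (ω : Alg q m →ₗ[ℝ] ℝ) : Prop where
  map_one : ω 1 = 1
  map_mul_a : ∀ (x : Alg q m) (i : ℕ+) (k : Fin m), ω (x * a q i k) = 0
  map_aDag_mul : ∀ (x : Alg q m) (i : ℕ+) (k : Fin m), ω (aDag q i k * x) = 0

/-- A Fock-like representation of the deformed quon algebra on a real vector space `V`, with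
a nonzero vacuum vector `|0⟩` killed by all annihilation operators. -/
structure FockRep (q : ℝ) (m : ℕ) (V : Type u) [AddCommGroup V] [Module ℝ V] where
  rep : Alg q m →ₐ[ℝ] Module.End ℝ V
  vac : V
  vac_ne_zero : vac ≠ 0
  rep_a_vac : ∀ (i : ℕ+) (k : Fin m), rep (a q i k) vac = 0

namespace FockRep

variable {q : ℝ} {m : ℕ} {V : Type u} [AddCommGroup V] [Module ℝ V]

/-- The linear map `x ↦ x |0⟩`. -/
noncomputable def orbit (F : FockRep q m V) : Alg q m →ₗ[ℝ] V :=
  (LinearMap.applyₗ F.vac).comp F.rep.toLinearMap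

/-- The space of particle states `H = {x |0⟩ | x ∈ A}`. -/
noncomputable def H (F : FockRep q m V) : Submodule ℝ V := LinearMap.range F.orbit

/-- The state `x |0⟩` as an element of `H`. -/
noncomputable def state (F : FockRep q m V) (x : Alg q m) : F.H :=
  ⟨F.rep x F.vac, x, rfl⟩

end FockRep

end Quon

/-! The algebra acts on the free Fock space of words: creators prepend a letter and annihilators act
as q-twisted derivations. In the form making them adjoint, words of different lengths are
orthogonal, and length-`n` words `v`, `w` pair to `∑ σ, q ^ inv σ * ∏ k, g (v k) (w (σ k))`, where
`g` is the one-particle Gram matrix.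

Positivity has two sources. The matrix `g` is an identity tensored with the `m × m` matrix with
diagonal `1` and off-diagonal `q`, whose eigenvalues `1 - q` and `1 + (m - 1) q` are positive in the
given range. The kernel `q ^ inv` on permutations is a principal submatrix of a tensor power of the
2 × 2 matrix of the same kind, because a permutation is determined by its inversion set. Tensoring
both kernels and averaging over permutations gives `gramFin_posDef`.

Normal ordering makes every element a polynomial in creators modulo the left ideal of annihilators.
This fixes the vacuum expectation and maps Fock space onto `H` in any Fock-like representation. The
kernel of that map is stable under annihilators and misses the vacuum, so nondegeneracy makes it
zero (`eq_bot_of_ann_stable`). The form on Fock space then transports to `H`. -/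

namespace Quon

open Matrix

/-! ### Positive definite kernels on arbitrary index types -/

section Kernels

variable {α β : Type*}

theorem sum_sum_toFinset (x : α →₀ ℝ) (M : Matrix α α ℝ) {s : Finset α} (hs : x.support ⊆ s) :
    (x.sum fun i xi => x.sum fun j xj => star xi * M i j * xj) =
      ∑ i ∈ s, ∑ j ∈ s, x i * M i j * x j := by
  rw [Finsupp.sum_of_support_subset x hs _ (by simp)]
  refine Finset.sum_congr rfl fun i _ => ?_
  rw [Finsupp.sum_of_support_subset x hs _ (by simp)]
  simp

/-- A real symmetric kernel is positive definite as soon as all its finite sections are. -/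
theorem posDef_of_finset {M : Matrix α α ℝ}
    (h : ∀ s : Finset α, (M.submatrix (Subtype.val : s → α) Subtype.val).PosDef) : M.PosDef := by
  classical
  refine ⟨?_, fun x hx => ?_⟩
  · ext i j
    have := (h {i, j}).1.apply ⟨i, by simp⟩ ⟨j, by simp⟩
    simpa using this
  · rw [sum_sum_toFinset x M subset_rfl]
    have h1 := (h x.support).dotProduct_mulVec_pos (x := fun i => x i) (by
      intro h0
      apply hx
      ext i
      by_cases hi : i ∈ x.support
      · exact congrFun h0 ⟨i, hi⟩
      · simpa using hi)
    convert h1 using 1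
    rw [← Finset.sum_coe_sort]
    simp only [dotProduct, mulVec, star_trivial, submatrix_apply]
    refine Finset.sum_congr rfl fun i _ => ?_
    rw [Finset.mul_sum, ← Finset.sum_coe_sort]
    exact Finset.sum_congr rfl fun j _ => by ring

/-- The Kronecker product of positive definite kernels on arbitrary index types. -/
theorem PosDef.kronecker' {M : Matrix α α ℝ} {N : Matrix β β ℝ} (hM : M.PosDef) (hN : N.PosDef) :
    (kroneckerMap (· * ·) M N).PosDef := by
  classical
  refine posDef_of_finset fun s => ?_
  -- A finite section lies inside the rectangle spanned by its two projections.
  have h := PosDef.kronecker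
    (hM.submatrix (e := (Subtype.val : s.image Prod.fst → α)) Subtype.val_injective)
    (hN.submatrix (e := (Subtype.val : s.image Prod.snd → β)) Subtype.val_injective)
  have h2 := h.submatrix (m := s)
    (e := fun p => (⟨p.1.1, Finset.mem_image_of_mem _ p.2⟩, ⟨p.1.2, Finset.mem_image_of_mem _ p.2⟩))
    (by
      rintro ⟨⟨a, b⟩, _⟩ ⟨⟨c, d⟩, _⟩ h
      simpa using h)
  exact h2

/-- The finite tensor power of a positive definite kernel. -/
def piKernel (ι : Type*) [Fintype ι] (M : Matrix α α ℝ) : Matrix (ι → α) (ι → α) ℝ :=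
  Matrix.of fun f g => ∏ i, M (f i) (g i)

theorem piKernel_fin_posDef {M : Matrix α α ℝ} (hM : M.PosDef) (n : ℕ) :
    (piKernel (Fin n) M).PosDef := by
  induction n with
  | zero =>
    have h : piKernel (Fin 0) M = 1 := by
      ext f g
      obtain rfl := Subsingleton.elim f g
      simp [piKernel]
    rw [h]
    exact PosDef.one
  | succ n ih =>
    have h := (PosDef.kronecker' hM ih).submatrix (m := Fin (n + 1) → α)
      (e := fun f => (f 0, fun i => f i.succ)) (by
        intro f g h
        simp only [Prod.mk.injEq] at h
        funext i
        exact Fin.cases h.1 (fun i => congrFun h.2 i) i)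
    convert h using 1
    ext f g
    simp [piKernel, Fin.prod_univ_succ]

theorem piKernel_posDef {ι : Type*} [Fintype ι] {M : Matrix α α ℝ} (hM : M.PosDef) :
    (piKernel ι M).PosDef := by
  have h := (piKernel_fin_posDef hM (Fintype.card ι)).submatrix (m := ι → α)
    (e := fun f i => f ((Fintype.equivFin ι).symm i)) (by
      intro f g h
      funext i
      simpa using congrFun h (Fintype.equivFin ι i))
  convert h using 1
  ext f g
  simp only [piKernel, of_apply, submatrix_apply]
  exact (Equiv.prod_comp (Fintype.equivFin ι).symm (fun i => M (f i) (g i))).symm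

/-- The matrix with diagonal entries `1` and all other entries `q`. -/
def uniformKernel (ι : Type*) [DecidableEq ι] (q : ℝ) : Matrix ι ι ℝ :=
  Matrix.of fun i j => if i = j then 1 else q

/-- The eigenvalues are `1 - q` on vectors of sum zero and `1 + (card - 1) q` on constants.
Cauchy–Schwarz replaces the diagonalization; it is needed only for `q ≤ 0`. -/
theorem uniformKernel_posDef {ι : Type*} [Fintype ι] [DecidableEq ι] {q : ℝ} (h1 : q < 1)
    (h2 : 0 < 1 + (Fintype.card ι - 1) * q) : (uniformKernel ι q).PosDef := by
  refine PosDef.of_dotProduct_mulVec_pos ?_ fun x hx => ?_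
  · ext i j
    simp [uniformKernel, eq_comm]
  · have e : star x ⬝ᵥ (uniformKernel ι q *ᵥ x) = (1 - q) * ∑ i, x i ^ 2 + q * (∑ i, x i) ^ 2 := by
      have e1 : ∀ i j, uniformKernel ι q i j = q + if i = j then 1 - q else 0 := by
        intro i j
        by_cases h : i = j <;> simp [uniformKernel, h]
      simp only [dotProduct, mulVec, star_trivial, e1, add_mul, Finset.sum_add_distrib, ite_mul,
        zero_mul, Finset.sum_ite_eq, Finset.mem_univ, if_true, mul_add]
      rw [add_comm, Finset.mul_sum, ← Finset.sum_mul]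
      congr 1
      · exact Finset.sum_congr rfl fun i _ => by ring
      · rw [← Finset.mul_sum]
        ring
    rw [e]
    have hpos : 0 < ∑ i, x i ^ 2 := by
      obtain ⟨i, hi⟩ := Function.ne_iff.1 hx
      exact Finset.sum_pos' (fun i _ => sq_nonneg _)
        ⟨i, Finset.mem_univ _, by simp only [Pi.zero_apply] at hi; positivity⟩
    have hcs : (∑ i, x i) ^ 2 ≤ Fintype.card ι * ∑ i, x i ^ 2 := by
      simpa using sq_sum_le_card_mul_sum_sq (s := Finset.univ) (f := x)
    rcases le_total 0 q with hq | hq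
    · have := mul_nonneg hq (sq_nonneg (∑ i, x i))
      have := mul_pos (sub_pos.2 h1) hpos
      linarith
    · have h3 := mul_le_mul_of_nonpos_left hcs hq
      have h4 := mul_pos h2 hpos
      linarith

/-- Averaging a positive definite kernel over a finite set of labels, when the partial averages do
not depend on the label. -/
theorem posDef_of_sum {G : Type*} [Fintype G] [Nonempty G] {M : Matrix (G × α) (G × α) ℝ}
    {N : Matrix α α ℝ} (hM : M.PosDef)
    (h : ∀ ρ v w, ∑ τ, M (ρ, v) (τ, w) = N v w) : N.PosDef := by
  classical
  have hN : ∀ v w, (Fintype.card G : ℝ) * N v w = ∑ ρ, ∑ τ, M (ρ, v) (τ, w) := by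
    intro v w
    simp [h]
  refine ⟨?_, fun x hx => ?_⟩
  · ext v w
    rw [conjTranspose_apply, star_trivial]
    refine mul_left_cancel₀ (a := (Fintype.card G : ℝ)) (by simp) ?_
    rw [hN, hN, Finset.sum_comm]
    exact Finset.sum_congr rfl fun ρ _ => Finset.sum_congr rfl fun τ _ => by
      simpa using hM.1.apply (ρ, v) (τ, w)
  rw [sum_sum_toFinset x N subset_rfl]
  -- Copying `x` onto every label turns the `M`-form of `y` into `card G` times the `N`-form of `x`.
  let y : G × α →₀ ℝ := Finsupp.onFinset (Finset.univ ×ˢ x.support) (fun p => x p.2) (by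
    rintro ⟨_, a⟩ h
    simpa using h)
  have hy : y ≠ 0 := by
    intro h0
    apply hx
    ext v
    exact DFunLike.congr_fun h0 (Classical.arbitrary G, v)
  have h1 := hM.2 hy
  rw [sum_sum_toFinset y M (s := Finset.univ ×ˢ x.support) Finsupp.support_onFinset_subset] at h1
  have h2 : ∑ p ∈ Finset.univ ×ˢ x.support, ∑ r ∈ Finset.univ ×ˢ x.support, y p * M p r * y r =
      Fintype.card G * ∑ v ∈ x.support, ∑ w ∈ x.support, x v * N v w * x w := by
    rw [Finset.sum_product]
    have : ∀ ρ : G, ∑ v ∈ x.support, ∑ r ∈ Finset.univ ×ˢ x.support, y (ρ, v) * M (ρ, v) r * y r =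
        ∑ v ∈ x.support, ∑ w ∈ x.support, x v * N v w * x w := by
      intro ρ
      refine Finset.sum_congr rfl fun v _ => ?_
      rw [Finset.sum_product_right]
      refine Finset.sum_congr rfl fun w _ => ?_
      rw [← h ρ v w, Finset.mul_sum, Finset.sum_mul]
      rfl
    simp [this]
  rw [h2] at h1
  exact pos_of_mul_pos_right h1 (by positivity)

/-- A graded kernel is positive definite as soon as its homogeneous parts are. -/
theorem posDef_of_grading {M : Matrix α α ℝ} (d : α → ℕ) (h0 : ∀ a b, d a ≠ d b → M a b = 0)
    (h : ∀ n, (M.submatrix (Subtype.val : {a // d a = n} → α) Subtype.val).PosDef) :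
    M.PosDef := by
  classical
  refine ⟨?_, fun x hx => ?_⟩
  · ext i j
    by_cases hij : d i = d j
    · have := (h (d j)).1.apply ⟨i, hij⟩ ⟨j, rfl⟩
      simpa using this
    · simp [h0 _ _ hij, h0 _ _ (Ne.symm hij)]
  · rw [sum_sum_toFinset x M subset_rfl]
    have key : ∀ n, (∑ a ∈ x.support with d a = n, ∑ b ∈ x.support, x a * M a b * x b) =
        (x.subtypeDomain (d · = n)).sum fun i xi => (x.subtypeDomain (d · = n)).sum fun j xj =>
          star xi * (M.submatrix (Subtype.val : {a // d a = n} → α) Subtype.val) i j * xj := by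
      intro n
      rw [sum_sum_toFinset _ _ subset_rfl, Finsupp.support_subtypeDomain]
      rw [← Finset.sum_subtype_eq_sum_filter]
      refine Finset.sum_congr rfl fun a _ => ?_
      change _ = ∑ b ∈ x.support.subtype (d · = n), x a * M a b * x b
      rw [Finset.sum_subtype_eq_sum_filter (f := fun b => x a * M a b * x b),
        Finset.sum_filter_of_ne]
      intro b _ hb
      by_contra hne
      exact hb (by rw [h0 _ _ (by rw [a.2]; exact Ne.symm hne)]; ring)
    -- The form splits over degrees; no degree contributes negatively, and one occurring in the
    -- support contributes positively.
    rw [← Finset.sum_fiberwise_of_maps_to (t := x.support.image d)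
      (fun a ha => Finset.mem_image_of_mem d ha)]
    simp only [key]
    obtain ⟨a, ha⟩ := Finsupp.support_nonempty_iff.2 hx
    refine Finset.sum_pos' (fun n _ => (h n).posSemidef.2 _)
      ⟨d a, Finset.mem_image_of_mem d ha, (h (d a)).2 fun hz => ?_⟩
    exact Finsupp.mem_support_iff.1 ha (DFunLike.congr_fun hz ⟨a, rfl⟩)

end Kernels

/-! ### The inversion kernel on permutations -/

section Permutations

variable {n : ℕ} {q : ℝ}

/-- `q` to the number of pairs which `ρ` and `τ` order differently. -/
def invWeight (q : ℝ) (ρ τ : Equiv.Perm (Fin n)) : ℝ :=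
  ∏ k, ∏ l, if ρ k < ρ l ∧ τ l < τ k then q else 1

/-- The indicator function of the inversion set of a permutation. -/
def inversionBits (ρ : Equiv.Perm (Fin n)) (p : Fin n × Fin n) : Bool :=
  decide (p.1 < p.2 ∧ ρ p.2 < ρ p.1)

theorem inversionBits_injective : Function.Injective (inversionBits (n := n)) := by
  intro ρ τ h
  have h1 : ∀ k l, k < l → (ρ l < ρ k ↔ τ l < τ k) := by
    intro k l hkl
    simpa [inversionBits, hkl] using congrFun h (k, l)
  have h2 : ∀ k l, ρ k < ρ l ↔ τ k < τ l := by
    intro k l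
    rcases lt_trichotomy k l with hkl | rfl | hkl
    · rw [← not_iff_not, not_lt, not_lt, le_iff_lt_or_eq, le_iff_lt_or_eq, h1 k l hkl,
        ρ.injective.eq_iff, τ.injective.eq_iff]
    · simp
    · exact h1 l k hkl
  -- Ordering all pairs alike makes `τ ∘ ρ⁻¹` an order automorphism of `Fin n`, hence the identity.
  let e : Fin n ≃o Fin n := ⟨ρ.symm.trans τ, by
    intro a b
    rw [← not_iff_not, not_le, not_le]
    simp [← h2]⟩
  have he : e = OrderIso.refl _ := Subsingleton.elim _ _
  ext k
  have := DFunLike.congr_fun he (ρ k)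
  simp only [OrderIso.refl_apply] at this
  rw [← this]
  simp [e]

/-- Each pair `k < l` contributes `q` exactly when the two inversion bits differ. Strict positivity
of the kernel for `|q| < 1` follows from this and `inversionBits_injective`. -/
theorem invWeight_eq_piKernel (ρ τ : Equiv.Perm (Fin n)) :
    invWeight q ρ τ =
      piKernel (Fin n × Fin n) (uniformKernel Bool q) (inversionBits ρ) (inversionBits τ) := by
  have h1 : ∀ k l : Fin n, (if ρ k < ρ l ∧ τ l < τ k then q else 1) =
      (if k < l ∧ ρ k < ρ l ∧ τ l < τ k then q else 1) *
        (if l < k ∧ ρ k < ρ l ∧ τ l < τ k then q else 1) := by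
    intro k l
    rcases lt_trichotomy k l with hkl | rfl | hkl
    · simp [hkl, hkl.not_gt]
    · simp
    · simp [hkl, hkl.not_gt]
  simp only [invWeight, h1, Finset.prod_mul_distrib]
  rw [Finset.prod_comm (f := fun k l => if l < k ∧ ρ k < ρ l ∧ τ l < τ k then q else 1)]
  simp only [← Finset.prod_mul_distrib]
  simp only [piKernel, of_apply, Fintype.prod_prod_type]
  refine Finset.prod_congr rfl fun k _ => Finset.prod_congr rfl fun l _ => ?_
  simp only [uniformKernel, inversionBits, of_apply]
  by_cases hkl : k < l
  · have hρ : ρ k ≠ ρ l := fun h => hkl.ne (ρ.injective h)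
    have hτ : τ k ≠ τ l := fun h => hkl.ne (τ.injective h)
    rcases lt_or_gt_of_ne hρ with h | h <;> rcases lt_or_gt_of_ne hτ with h' | h' <;>
      simp [hkl, h, h', h.not_gt, h'.not_gt]
  · simp [hkl]

theorem invWeight_mul_right (ρ σ : Equiv.Perm (Fin n)) :
    invWeight q ρ (σ * ρ) = invWeight q 1 σ := by
  unfold invWeight
  conv_rhs => rw [← Equiv.prod_comp ρ]
  refine Finset.prod_congr rfl fun k _ => ?_
  conv_rhs => rw [← Equiv.prod_comp ρ]
  rfl

/-- The permutation sending `0` to `k` and otherwise ordered like `τ`. -/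
def insertPerm (p : Fin (n + 1) × Equiv.Perm (Fin n)) : Equiv.Perm (Fin (n + 1)) :=
  p.1.cycleRange.symm * Equiv.Perm.decomposeFin.symm (0, p.2)

theorem insertPerm_zero (p : Fin (n + 1) × Equiv.Perm (Fin n)) : insertPerm p 0 = p.1 := by
  simp [insertPerm]

theorem insertPerm_succ (p : Fin (n + 1) × Equiv.Perm (Fin n)) (l : Fin n) :
    insertPerm p l.succ = p.1.succAbove (p.2 l) := by
  simp [insertPerm]

theorem insertPerm_bijective : Function.Bijective (insertPerm (n := n)) := by
  rw [Fintype.bijective_iff_injective_and_card]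
  refine ⟨?_, by simp [Fintype.card_perm, Nat.factorial_succ]⟩
  rintro ⟨k, τ⟩ ⟨k', τ'⟩ h
  have h0 : k = k' := by
    simpa [insertPerm_zero] using DFunLike.congr_fun h 0
  subst h0
  congr 1
  ext l
  have := DFunLike.congr_fun h l.succ
  simp only [insertPerm_succ] at this
  rw [Fin.succAbove_right_injective this]

/-- Sending `0` to `k` inverts it with exactly the `k` positions whose images lie below `k`; the
other inversions are those of `τ`. -/
theorem invWeight_insertPerm (k : Fin (n + 1)) (τ : Equiv.Perm (Fin n)) :
    invWeight q 1 (insertPerm (k, τ)) = q ^ (k : ℕ) * invWeight q 1 τ := by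
  unfold invWeight
  rw [Fin.prod_univ_succ]
  congr 1
  · rw [Fin.prod_univ_succ]
    simp only [Equiv.Perm.coe_one, id_eq, lt_self_iff_false, false_and, if_false, one_mul,
      Fin.succ_pos, true_and, insertPerm_zero, insertPerm_succ]
    rw [Equiv.prod_comp τ (fun l => if k.succAbove l < k then q else 1)]
    simp only [Fin.succAbove_lt_iff_castSucc_lt]
    rw [← Finset.prod_filter, Finset.prod_const]
    congr 1
    have := Fin.card_filter_val_lt (n := n) (m := k)
    simpa [Fin.lt_def, Nat.le_of_lt_succ k.2] using this
  · refine Finset.prod_congr rfl fun i _ => ?_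
    rw [Fin.prod_univ_succ]
    simp only [insertPerm_zero, insertPerm_succ, Fin.succAbove_lt_succAbove_iff,
      Equiv.Perm.coe_one, id_eq, Fin.not_lt_zero, false_and, if_false, one_mul,
      Fin.succ_lt_succ_iff]
    exact Finset.prod_congr rfl fun l _ => by congr

end Permutations

/-! ### Positivity of the n-particle Gram matrix -/

section Gram

variable {I : Type*}

/-- The Gram matrix of the `n`-particle words. -/
def gramFin (g : Matrix I I ℝ) (q : ℝ) (n : ℕ) : Matrix (Fin n → I) (Fin n → I) ℝ :=
  Matrix.of fun v w => ∑ σ : Equiv.Perm (Fin n), invWeight q 1 σ * ∏ k, g (v k) (w (σ k))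

theorem gramFin_posDef {g : Matrix I I ℝ} {q : ℝ} (hg : g.PosDef) (h1 : -1 < q) (h2 : q < 1)
    (n : ℕ) : (gramFin g q n).PosDef := by
  have hK : (uniformKernel Bool q).PosDef :=
    uniformKernel_posDef h2 (by norm_num; linarith)
  have hM := (PosDef.kronecker' (piKernel_posDef (ι := Fin n × Fin n) hK)
    (piKernel_posDef (ι := Fin n) hg)).submatrix (m := Equiv.Perm (Fin n) × (Fin n → I))
    -- Twisting the word by `ρ` makes the kernel invariant under simultaneous right translation of
    -- permutations, so its row sums do not depend on `ρ`.
    (e := fun p => (inversionBits p.1, fun k => p.2 (p.1 k))) (by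
      rintro ⟨ρ, v⟩ ⟨τ, w⟩ h
      simp only [Prod.mk.injEq] at h
      obtain rfl := inversionBits_injective h.1
      have : v = w := by
        funext k
        simpa using congrFun h.2 (ρ.symm k)
      rw [this])
  refine posDef_of_sum hM fun ρ v w => ?_
  rw [← Equiv.sum_comp (Equiv.mulRight ρ)]
  refine Finset.sum_congr rfl fun σ _ => ?_
  simp only [submatrix_apply, kroneckerMap_apply, ← invWeight_eq_piKernel, Equiv.coe_mulRight,
    invWeight_mul_right]
  congr 1
  simp only [piKernel, of_apply, Equiv.Perm.mul_apply]
  exact Equiv.prod_comp ρ (fun k => g (v k) (w (σ k)))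

/-- Expansion along the image of `0`, the analogue of a Laplace expansion; it matches the
annihilator's recursion in `annWord_ofFn`. -/
theorem gramFin_cons (g : Matrix I I ℝ) (q : ℝ) {n : ℕ} (i : I) (v : Fin n → I)
    (w : Fin (n + 1) → I) :
    gramFin g q (n + 1) (Fin.cons i v) w =
      ∑ k : Fin (n + 1), q ^ (k : ℕ) * g i (w k) * gramFin g q n v (fun l => w (k.succAbove l)) := by
  simp only [gramFin, of_apply]
  rw [← Equiv.sum_comp (Equiv.ofBijective _ insertPerm_bijective), Fintype.sum_prod_type]
  refine Finset.sum_congr rfl fun k _ => ?_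
  rw [Finset.mul_sum]
  refine Finset.sum_congr rfl fun τ _ => ?_
  simp only [Equiv.ofBijective_apply, invWeight_insertPerm, Fin.prod_univ_succ, Fin.cons_zero,
    Fin.cons_succ, insertPerm_zero, insertPerm_succ]
  ring

end Gram

/-! ### Fock space and its form -/

section Fock

variable {I : Type*}

/-- The algebraic Fock space: real combinations of words of creators applied to the vacuum `[]`. -/
abbrev Fock (I : Type*) : Type _ := List I →₀ ℝ

namespace Fock

/-- The vacuum vector. -/
noncomputable def vacuum : Fock I := Finsupp.single [] 1

/-- The creation operator. -/
noncomputable def cre (i : I) : Fock I →ₗ[ℝ] Fock I := Finsupp.lmapDomain ℝ ℝ (List.cons i)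

@[simp]
theorem cre_single (i : I) (w : List I) (c : ℝ) :
    cre i (Finsupp.single w c) = Finsupp.single (i :: w) c := by
  simp [cre]

/-- The annihilation operator on words. -/
noncomputable def annWord (g : Matrix I I ℝ) (q : ℝ) (i : I) : List I → Fock I
  | [] => 0
  | j :: w => g i j • Finsupp.single w 1 + q • cre j (annWord g q i w)

/-- The annihilation operator. -/
noncomputable def ann (g : Matrix I I ℝ) (q : ℝ) (i : I) : Fock I →ₗ[ℝ] Fock I :=
  Finsupp.linearCombination ℝ (annWord g q i)

variable (g : Matrix I I ℝ) (q : ℝ)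

theorem ann_single (i : I) (w : List I) : ann g q i (Finsupp.single w 1) = annWord g q i w := by
  simp [ann]

@[simp]
theorem ann_vacuum (i : I) : ann g q i vacuum = 0 := by
  rw [vacuum, ann_single, annWord]

theorem ann_cre (i j : I) (p : Fock I) :
    ann g q i (cre j p) = g i j • p + q • cre j (ann g q i p) := by
  have h : (ann g q i) ∘ₗ (cre j) = g i j • LinearMap.id + q • (cre j) ∘ₗ (ann g q i) := by
    refine Finsupp.lhom_ext' fun w => LinearMap.ext_ring ?_
    simp [ann_single, annWord]
  exact DFunLike.congr_fun h p

theorem annWord_mem_supported (i : I) (w : List I) :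
    annWord g q i w ∈ Finsupp.supported ℝ ℝ {u : List I | u.length + 1 = w.length} := by
  induction w with
  | nil => exact Submodule.zero_mem _
  | cons j w ih =>
    refine Submodule.add_mem _ (Submodule.smul_mem _ _ ?_) (Submodule.smul_mem _ _ ?_)
    · exact Finsupp.single_mem_supported ℝ _ (by simp)
    · have h := Finsupp.lmapDomain_supported ℝ ℝ (List.cons j) {u : List I | u.length + 1 = w.length}
      have h2 : cre j (annWord g q i w) ∈ Finsupp.supported ℝ ℝ
          (List.cons j '' {u : List I | u.length + 1 = w.length}) := by
        rw [← h]
        exact Submodule.mem_map_of_mem ih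
      refine Finsupp.supported_mono ?_ h2
      rintro _ ⟨u, hu, rfl⟩
      simpa using hu

theorem ann_mem_supported (i : I) {n : ℕ} {p : Fock I}
    (hp : p ∈ Finsupp.supported ℝ ℝ {u : List I | u.length < n + 1}) :
    ann g q i p ∈ Finsupp.supported ℝ ℝ {u : List I | u.length < n} := by
  rw [ann, Finsupp.linearCombination_apply]
  refine Submodule.sum_mem _ fun w hw => Submodule.smul_mem _ _ ?_
  refine Finsupp.supported_mono ?_ (annWord_mem_supported g q i w)
  intro u hu
  have h1 : w.length < n + 1 := hp hw
  simp only [Set.mem_ofPred_eq] at hu ⊢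
  omega

/-- The pairing with a word. -/
noncomputable def pair : List I → Fock I →ₗ[ℝ] ℝ
  | [] => Finsupp.lapply []
  | i :: v => (pair v).comp (ann g q i)

/-- The Gram matrix of the words. -/
noncomputable def gram : Matrix (List I) (List I) ℝ :=
  Matrix.of fun v w => pair g q v (Finsupp.single w 1)

/-- The bilinear form for which annihilators are adjoint to creators. -/
noncomputable def form : Fock I →ₗ[ℝ] Fock I →ₗ[ℝ] ℝ :=
  Finsupp.linearCombination ℝ (pair g q)

theorem form_single (v : List I) (r : Fock I) :
    form g q (Finsupp.single v 1) r = pair g q v r := by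
  simp [form]

theorem form_vacuum (r : Fock I) : form g q vacuum r = r [] := by
  rw [vacuum, form_single]
  rfl

theorem form_cre (i : I) (p r : Fock I) : form g q (cre i p) r = form g q p (ann g q i r) := by
  have h : (form g q) ∘ₗ (cre i) = (LinearMap.lcomp ℝ ℝ (ann g q i)) ∘ₗ (form g q) := by
    refine Finsupp.lhom_ext' fun w => LinearMap.ext_ring ?_
    refine LinearMap.ext fun r => ?_
    simp [form_single, pair]
  exact DFunLike.congr_fun (DFunLike.congr_fun h p) r

theorem form_eq_sum (p r : Fock I) :
    form g q p r = p.sum fun v c => r.sum fun w d => c * gram g q v w * d := by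
  have h : ∀ v, pair g q v r = r.sum fun w d => gram g q v w * d := by
    intro v
    conv_lhs => rw [← Finsupp.sum_single r]
    rw [map_finsuppSum]
    refine Finsupp.sum_congr fun w _ => ?_
    rw [← mul_one (r w), ← smul_eq_mul, ← Finsupp.smul_single, map_smul, gram, of_apply,
      smul_eq_mul, mul_comm, smul_eq_mul, mul_one]
  rw [form, Finsupp.linearCombination_apply, Finsupp.sum, LinearMap.sum_apply]
  refine Finset.sum_congr rfl fun v _ => ?_
  rw [LinearMap.smul_apply, h, smul_eq_mul, Finsupp.mul_sum]
  exact Finsupp.sum_congr fun w _ => by ring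

theorem gram_eq_zero {v w : List I} (h : v.length ≠ w.length) : gram g q v w = 0 := by
  have key : ∀ (v : List I) (p : Fock I),
      p ∈ Finsupp.supported ℝ ℝ {u : List I | u.length ≠ v.length} → pair g q v p = 0 := by
    intro v
    induction v with
    | nil =>
      intro p hp
      by_contra h0
      exact hp (Finsupp.mem_support_iff.2 h0) rfl
    | cons i v ih =>
      intro p hp
      refine ih _ ?_
      rw [ann, Finsupp.linearCombination_apply]
      refine Submodule.sum_mem _ fun w hw => Submodule.smul_mem _ _ ?_
      refine Finsupp.supported_mono ?_ (annWord_mem_supported g q i w)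
      intro u hu
      have h1 : w.length ≠ (i :: v).length := hp hw
      simp only [Set.mem_ofPred_eq, List.length_cons] at hu h1 ⊢
      omega
  exact key v _ (Finsupp.single_mem_supported ℝ _ h.symm)

theorem annWord_ofFn (i : I) (n : ℕ) (w : Fin (n + 1) → I) :
    annWord g q i (List.ofFn w) = ∑ k : Fin (n + 1), (q ^ (k : ℕ) * g i (w k)) •
      Finsupp.single (List.ofFn fun l => w (k.succAbove l)) (1 : ℝ) := by
  induction n with
  | zero => simp [annWord]
  | succ n ih =>
    conv_rhs => rw [Fin.sum_univ_succ]
    rw [List.ofFn_succ, annWord, ih]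
    congr 1
    · simp
    · rw [map_sum, Finset.smul_sum]
      refine Finset.sum_congr rfl fun k _ => ?_
      rw [map_smul, cre_single, smul_smul]
      conv_rhs => rw [List.ofFn_succ]
      simp [pow_succ', mul_assoc]

theorem gram_ofFn (n : ℕ) (v w : Fin n → I) :
    gram g q (List.ofFn v) (List.ofFn w) = gramFin g q n v w := by
  induction n with
  | zero => simp [gram, gramFin, pair, invWeight]
  | succ n ih =>
    obtain ⟨i, v, rfl⟩ : ∃ i v', v = Fin.cons i v' := ⟨v 0, Fin.tail v, by simp⟩
    rw [gramFin_cons, gram, of_apply, List.ofFn_succ, pair, LinearMap.comp_apply, ann_single,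
      annWord_ofFn, map_sum]
    refine Finset.sum_congr rfl fun k _ => ?_
    rw [map_smul, ← ih, gram, of_apply, smul_eq_mul]
    simp

variable {g q}

theorem gram_posDef (hg : g.PosDef) (h1 : -1 < q) (h2 : q < 1) : (gram g q).PosDef := by
  refine posDef_of_grading List.length (fun v w h => gram_eq_zero g q h) fun n => ?_
  have h := (gramFin_posDef hg h1 h2 n).submatrix (m := {v : List I // v.length = n})
    (e := fun v k => v.1.get (k.cast v.2.symm)) (by
      rintro ⟨v, hv⟩ ⟨w, rfl⟩ h
      refine Subtype.ext (List.ext_get hv fun k hk hk' => ?_)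
      exact congrFun h ⟨k, hk'⟩)
  convert h using 1
  ext ⟨v, rfl⟩ ⟨w, hw⟩
  simp only [submatrix_apply, ← gram_ofFn]
  congr 1
  · simp
  · refine List.ext_get (by simpa using hw) fun k hk hk' => ?_
    simp

/-- The definition treats the two arguments differently; symmetry is read off from the explicit Gram
matrix through `hG`. -/
theorem form_symm (hG : (gram g q).PosDef) (p r : Fock I) : form g q p r = form g q r p := by
  rw [form_eq_sum, form_eq_sum, Finsupp.sum_comm]
  refine Finsupp.sum_congr fun v _ => Finsupp.sum_congr fun w _ => ?_
  have := hG.1.apply v w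
  rw [star_trivial] at this
  rw [this]
  ring

theorem form_pos (hG : (gram g q).PosDef) {p : Fock I} (hp : p ≠ 0) : 0 < form g q p p := by
  rw [form_eq_sum]
  simpa using hG.2 hp

theorem form_ann (hG : (gram g q).PosDef) (i : I) (p r : Fock I) :
    form g q (ann g q i p) r = form g q p (cre i r) := by
  rw [form_symm hG, ← form_cre, form_symm hG]

theorem eq_zero_of_pair_eq_zero (hG : (gram g q).PosDef) {p : Fock I}
    (h : ∀ v, pair g q v p = 0) : p = 0 := by
  by_contra hp
  refine (form_pos hG hp).ne' ?_
  rw [form, Finsupp.linearCombination_apply, Finsupp.sum, LinearMap.sum_apply]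
  exact Finset.sum_eq_zero fun v _ => by rw [LinearMap.smul_apply, h, smul_zero]

/-- A subspace stable under annihilation which does not contain the vacuum is trivial. -/
theorem eq_bot_of_ann_stable (hG : (gram g q).PosDef) (K : Submodule ℝ (Fock I))
    (hK : ∀ i, ∀ p ∈ K, ann g q i p ∈ K) (h0 : vacuum ∉ K) : K = ⊥ := by
  have key : ∀ n, ∀ p ∈ K, p ∈ Finsupp.supported ℝ ℝ {u : List I | u.length < n} → p = 0 := by
    intro n
    induction n with
    | zero =>
      intro p _ hp
      simpa using hp
    | succ n ih =>
      intro p hpK hp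
      have ha : ∀ i, ann g q i p = 0 := fun i => ih _ (hK i p hpK) (ann_mem_supported g q i hp)
      -- Every nonempty word pairs through an annihilator, so a vector killed by all annihilators is
      -- a multiple of the vacuum.
      have hz : p - p [] • vacuum = 0 := by
        refine eq_zero_of_pair_eq_zero hG fun v => ?_
        cases v with
        | nil => simp [pair, vacuum]
        | cons i v => simp [pair, ha]
      rw [sub_eq_zero] at hz
      by_cases hc : p [] = 0
      · rw [hz, hc, zero_smul]
      · refine absurd ?_ h0
        rw [hz] at hpK
        exact (K.smul_mem_iff hc).1 hpK
  rw [Submodule.eq_bot_iff]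
  intro p hp
  refine key (p.support.sup List.length + 1) p hp fun u hu => ?_
  exact Nat.lt_succ_of_le (Finset.le_sup (f := List.length) hu)

end Fock

end Fock

open Fock

/-! ### The one-particle matrix and the Fock representation -/

section Representation

variable {q : ℝ} {m : ℕ}

/-- The Gram matrix `⟨0| a_p a_r^† |0⟩` of the one-particle states. -/
def oneParticle (q : ℝ) (m : ℕ) : Matrix (ℕ+ × Fin m) (ℕ+ × Fin m) ℝ :=
  Matrix.of fun p r => q ^ beta r.2 p.2 * if r.1 = p.1 then 1 else 0

theorem beta_eq {m : ℕ} (k l : Fin m) : beta k l = if k = l then 0 else 1 := by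
  unfold beta
  refine if_congr ?_ rfl rfl
  rw [Int.modEq_iff_dvd]
  constructor
  · rintro ⟨c, hc⟩
    have hk := k.2
    have hl := l.2
    have hm : (m : ℤ) ∣ (l : ℤ) - (k : ℤ) := ⟨1 - c, by linarith⟩
    have h0 := Int.eq_zero_of_abs_lt_dvd hm (by rw [abs_lt]; omega)
    ext
    omega
  · rintro rfl
    simp

theorem oneParticle_posDef (hq : (m = 1 ∧ -1 < q ∧ q < 1) ∨ (1 < m ∧ 1 / (1 - (m : ℝ)) < q ∧ q < 1)) :
    (oneParticle q m).PosDef := by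
  have h : (uniformKernel (Fin m) q).PosDef := by
    rcases hq with ⟨rfl, _, h2⟩ | ⟨hm, h1, h2⟩
    · exact uniformKernel_posDef h2 (by simp)
    · refine uniformKernel_posDef h2 ?_
      have hm' : (1 : ℝ) < m := by exact_mod_cast hm
      rw [div_lt_iff_of_neg (by linarith)] at h1
      rw [Fintype.card_fin]
      linarith
  have h2 := PosDef.kronecker' (Matrix.PosDef.one (n := ℕ+) (R := ℝ)) h
  convert h2 using 1
  ext ⟨i, k⟩ ⟨j, l⟩
  simp only [oneParticle, Matrix.of_apply, Matrix.kroneckerMap_apply, uniformKernel, beta_eq,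
    Matrix.one_apply, eq_comm (a := l), eq_comm (a := j)]
  by_cases h1 : i = j <;> by_cases h2 : k = l <;> simp [h1, h2]

theorem gram_oneParticle_posDef
    (hq : (m = 1 ∧ -1 < q ∧ q < 1) ∨ (1 < m ∧ 1 / (1 - (m : ℝ)) < q ∧ q < 1)) :
    (gram (oneParticle q m) q).PosDef := by
  refine gram_posDef (oneParticle_posDef hq) ?_ ?_
  · rcases hq with ⟨_, h, _⟩ | ⟨hm, h, _⟩
    · exact h
    · refine lt_of_le_of_lt ?_ h
      -- For `m ≥ 2` the lower bound `1 / (1 - m)` is at least `-1`, so the inversion kernel needs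
      -- no extra assumption.
      have hm' : (2 : ℝ) ≤ m := by exact_mod_cast hm
      rw [le_div_iff_of_neg (by linarith)]
      linarith
  · rcases hq with ⟨_, _, h⟩ | ⟨_, _, h⟩ <;> exact h

/-- The representation of the deformed quon algebra on the algebraic Fock space. -/
noncomputable def fockAction (q : ℝ) (m : ℕ) : Alg q m →ₐ[ℝ] Module.End ℝ (Fock (ℕ+ × Fin m)) :=
  RingQuot.liftAlgHom ℝ
    ⟨FreeAlgebra.lift ℝ (fun g : Gen m => match g with
        | Gen.ann i k => Fock.ann (oneParticle q m) q (i, k)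
        | Gen.cre i k => Fock.cre (i, k)), by
      intro x y h
      cases h with
      | comm j l i k =>
        simp only [map_mul, map_add, map_smul, map_one, FreeAlgebra.lift_ι_apply]
        refine LinearMap.ext fun p => ?_
        by_cases h : i = j <;> simp [ann_cre, oneParticle, add_comm, h]⟩

@[simp]
theorem fockAction_a (i : ℕ+) (k : Fin m) :
    fockAction q m (a q i k) = Fock.ann (oneParticle q m) q (i, k) := by
  unfold fockAction a mk
  erw [RingQuot.liftAlgHom_mkAlgHom_apply]
  simp

@[simp]
theorem fockAction_aDag (i : ℕ+) (k : Fin m) :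
    fockAction q m (aDag q i k) = Fock.cre (i, k) := by
  unfold fockAction aDag mk
  erw [RingQuot.liftAlgHom_mkAlgHom_apply]
  simp

@[elab_as_elim]
theorem Alg.induction {P : Alg q m → Prop} (algebraMap : ∀ r, P (algebraMap ℝ _ r))
    (a : ∀ i k, P (a q i k)) (aDag : ∀ i k, P (aDag q i k))
    (mul : ∀ x y, P x → P y → P (x * y)) (add : ∀ x y, P x → P y → P (x + y))
    (x : Alg q m) : P x := by
  obtain ⟨x, rfl⟩ := RingQuot.mkAlgHom_surjective ℝ (Rel q m) x
  change P (mk q m x)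
  induction x using FreeAlgebra.induction with
  | grade0 r =>
    rw [AlgHom.commutes]
    exact algebraMap r
  | grade1 x =>
    cases x with
    | ann i k => exact a i k
    | cre i k => exact aDag i k
  | mul x y hx hy => rw [map_mul]; exact mul _ _ hx hy
  | add x y hx hy => rw [map_add]; exact add _ _ hx hy

/-! ### Normal ordering and the vacuum expectation -/

/-- The product of creators along a word. -/
noncomputable def creWord (q : ℝ) {m : ℕ} (w : List (ℕ+ × Fin m)) : Alg q m :=
  (w.map fun p => aDag q p.1 p.2).prod

/-- The polynomial in the creators attached to a Fock space vector. -/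
noncomputable def crePoly (q : ℝ) (m : ℕ) : Fock (ℕ+ × Fin m) →ₗ[ℝ] Alg q m :=
  Finsupp.linearCombination ℝ (creWord q)

theorem crePoly_single (w : List (ℕ+ × Fin m)) :
    crePoly q m (Finsupp.single w 1) = creWord q w := by
  simp [crePoly]

theorem crePoly_vacuum : crePoly q m vacuum = 1 := by
  rw [vacuum, crePoly_single]
  rfl

theorem crePoly_cre (p : ℕ+ × Fin m) (r : Fock (ℕ+ × Fin m)) :
    crePoly q m (cre p r) = aDag q p.1 p.2 * crePoly q m r := by
  have h : (crePoly q m) ∘ₗ (cre p) = (LinearMap.mulLeft ℝ (aDag q p.1 p.2)) ∘ₗ (crePoly q m) := by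
    refine Finsupp.lhom_ext' fun w => LinearMap.ext_ring ?_
    simp [crePoly_single, creWord]
  exact DFunLike.congr_fun h r

/-- The left ideal generated by the annihilators. -/
noncomputable def annIdeal (q : ℝ) (m : ℕ) : Ideal (Alg q m) :=
  Ideal.span (Set.range fun p : ℕ+ × Fin m => a q p.1 p.2)

theorem smul_mem_annIdeal (c : ℝ) {x : Alg q m} (hx : x ∈ annIdeal q m) : c • x ∈ annIdeal q m := by
  rw [Algebra.smul_def]
  exact Ideal.mul_mem_left _ _ hx

theorem a_mul_crePoly_sub_mem (i : ℕ+) (k : Fin m) (r : Fock (ℕ+ × Fin m)) :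
    a q i k * crePoly q m r - crePoly q m (Fock.ann (oneParticle q m) q (i, k) r) ∈ annIdeal q m := by
  induction r using Finsupp.induction_linear with
  | zero => simp
  | add p r hp hr =>
    rw [map_add, map_add, map_add, mul_add, add_sub_add_comm]
    exact Ideal.add_mem _ hp hr
  | single w c =>
    rw [← Finsupp.smul_single_one, map_smul, map_smul, map_smul,
      mul_smul_comm, ← smul_sub]
    refine smul_mem_annIdeal _ ?_
    induction w with
    | nil =>
      change a q i k * crePoly q m vacuum - crePoly q m (Fock.ann _ q (i, k) vacuum) ∈ _
      rw [crePoly_vacuum, ann_vacuum, map_zero, sub_zero, mul_one]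
      exact Ideal.subset_span ⟨(i, k), rfl⟩
    | cons p w ih =>
      rw [← cre_single, crePoly_cre, ann_cre, map_add, map_smul, map_smul, crePoly_cre,
        ← mul_assoc, a_mul_aDag, add_mul, smul_mul_assoc, smul_mul_assoc, one_mul]
      have e : oneParticle q m (i, k) p = q ^ beta p.2 k * if p.1 = i then 1 else 0 := rfl
      rw [e]
      convert smul_mem_annIdeal q (Ideal.mul_mem_left _ (aDag q p.1 p.2) ih) using 1
      rw [mul_sub, smul_sub, mul_assoc]
      abel

/-- Modulo the left ideal of annihilators, left multiplication on creator polynomials is the Fock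
action. -/
theorem mul_crePoly_sub_mem (x : Alg q m) (r : Fock (ℕ+ × Fin m)) :
    x * crePoly q m r - crePoly q m (fockAction q m x r) ∈ annIdeal q m := by
  induction x using Alg.induction generalizing r with
  | algebraMap c => simp [Algebra.algebraMap_eq_smul_one]
  | a i k =>
    rw [fockAction_a]
    exact a_mul_crePoly_sub_mem i k r
  | aDag i k => simp [crePoly_cre]
  | mul x y hx hy =>
    have h := Ideal.add_mem _ (Ideal.mul_mem_left _ x (hy r)) (hx (fockAction q m y r))
    rw [map_mul, Module.End.mul_apply]
    convert h using 1
    noncomm_ring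
  | add x y hx hy =>
    rw [map_add, LinearMap.add_apply, map_add, add_mul, add_sub_add_comm]
    exact Ideal.add_mem _ (hx r) (hy r)

theorem sub_crePoly_mem (x : Alg q m) : x - crePoly q m (fockAction q m x vacuum) ∈ annIdeal q m := by
  simpa [crePoly_vacuum] using mul_crePoly_sub_mem x vacuum

/-- The vacuum expectation. -/
noncomputable def vacuumExpectation (q : ℝ) (m : ℕ) : Alg q m →ₗ[ℝ] ℝ :=
  Finsupp.lapply [] ∘ₗ LinearMap.applyₗ vacuum ∘ₗ (fockAction q m).toLinearMap

theorem vacuumExpectation_apply (x : Alg q m) :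
    vacuumExpectation q m x = fockAction q m x vacuum [] := rfl

theorem cre_apply_nil (p : ℕ+ × Fin m) (r : Fock (ℕ+ × Fin m)) : cre p r [] = 0 := by
  rw [cre, Finsupp.lmapDomain_apply]
  exact Finsupp.mapDomain_of_notMem_range _ _ (by simp)

theorem vacuumExpectation_isVacuumExpectation : IsVacuumExpectation (vacuumExpectation q m) where
  map_one := by simp [vacuumExpectation_apply, vacuum]
  map_mul_a x i k := by simp [vacuumExpectation_apply]
  map_aDag_mul x i k := by simp [vacuumExpectation_apply, cre_apply_nil]

/-- Such a functional kills the left ideal of annihilators and reads off the empty-word coefficient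
of a creator polynomial; normal ordering leaves no other freedom. -/
theorem IsVacuumExpectation.eq {ω : Alg q m →ₗ[ℝ] ℝ} (hω : IsVacuumExpectation ω) :
    ω = vacuumExpectation q m := by
  have hJ : ∀ x ∈ annIdeal q m, ∀ y, ω (y * x) = 0 := by
    intro x hx
    induction hx using Submodule.span_induction with
    | mem x hx =>
      obtain ⟨p, rfl⟩ := hx
      exact fun y => hω.map_mul_a y p.1 p.2
    | zero => simp
    | add x y _ _ hx hy =>
      intro z
      rw [mul_add, map_add, hx, hy, add_zero]
    | smul z x _ hx =>
      intro y
      rw [smul_eq_mul, ← mul_assoc, hx]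
  have hp : ω ∘ₗ crePoly q m = Finsupp.lapply [] := by
    refine Finsupp.lhom_ext' fun w => LinearMap.ext_ring ?_
    cases w with
    | nil => simp [crePoly_single, creWord, hω.map_one]
    | cons p w => simp [crePoly_single, creWord, hω.map_aDag_mul]
  ext x
  have h := hJ _ (sub_crePoly_mem x) 1
  rw [one_mul, map_sub, sub_eq_zero] at h
  rw [h]
  exact DFunLike.congr_fun hp _

theorem form_fockAction (hG : (gram (oneParticle q m) q).PosDef) (x : Alg q m)
    (p r : Fock (ℕ+ × Fin m)) :
    form (oneParticle q m) q (fockAction q m x p) r =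
      form (oneParticle q m) q p (fockAction q m (star x) r) := by
  induction x using Alg.induction generalizing p r with
  | algebraMap c => simp [Algebra.algebraMap_eq_smul_one]
  | a i k => rw [star_a, fockAction_a, fockAction_aDag, form_ann hG]
  | aDag i k => rw [← star_a, star_star, fockAction_a, star_a, fockAction_aDag, form_cre]
  | mul x y hx hy => rw [star_mul, map_mul, map_mul, Module.End.mul_apply, Module.End.mul_apply, hx, hy]
  | add x y hx hy =>
    rw [star_add, map_add, map_add, LinearMap.add_apply, LinearMap.add_apply, map_add, map_add,
      LinearMap.add_apply, hx, hy]

theorem form_fockAction_vacuum (hG : (gram (oneParticle q m) q).PosDef) (x y : Alg q m) :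
    form (oneParticle q m) q (fockAction q m x vacuum) (fockAction q m y vacuum) =
      vacuumExpectation q m (star x * y) := by
  rw [form_fockAction hG, form_vacuum, vacuumExpectation_apply, map_mul, Module.End.mul_apply]

/-- The algebraic Fock space as a Fock-like representation. -/
noncomputable def fockRep (q : ℝ) (m : ℕ) : FockRep q m (Fock (ℕ+ × Fin m)) where
  rep := fockAction q m
  vac := vacuum
  vac_ne_zero := by simp [vacuum]
  rep_a_vac i k := by simp

/-! ### Comparison of Fock space with an arbitrary Fock-like representation -/

namespace FockRep

variable {V : Type u} [AddCommGroup V] [Module ℝ V] (F : FockRep q m V)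

theorem rep_vac_of_mem_annIdeal {x : Alg q m} (hx : x ∈ annIdeal q m) : F.rep x F.vac = 0 := by
  induction hx using Submodule.span_induction with
  | mem x hx =>
    obtain ⟨p, rfl⟩ := hx
    exact F.rep_a_vac p.1 p.2
  | zero => simp
  | add x y _ _ hx hy => rw [map_add, LinearMap.add_apply, hx, hy, add_zero]
  | smul z x _ hx => rw [smul_eq_mul, map_mul, Module.End.mul_apply, hx, map_zero]

theorem state_crePoly (x : Alg q m) (p : Fock (ℕ+ × Fin m)) :
    F.rep (crePoly q m (fockAction q m x p)) F.vac = F.rep x (F.rep (crePoly q m p) F.vac) := by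
  have h := F.rep_vac_of_mem_annIdeal (mul_crePoly_sub_mem x p)
  rw [map_sub, LinearMap.sub_apply, sub_eq_zero, map_mul, Module.End.mul_apply] at h
  exact h.symm

/-- The map from the algebraic Fock space onto the space of states. -/
noncomputable def fromFock : Fock (ℕ+ × Fin m) →ₗ[ℝ] F.H :=
  F.orbit.rangeRestrict ∘ₗ crePoly q m

theorem fromFock_fockAction_vacuum (x : Alg q m) :
    F.fromFock (fockAction q m x vacuum) = F.state x := by
  refine Subtype.ext ?_
  change F.rep (crePoly q m (fockAction q m x vacuum)) F.vac = F.rep x F.vac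
  simp [state_crePoly, crePoly_vacuum]

theorem fromFock_surjective : Function.Surjective F.fromFock := by
  rintro ⟨_, x, rfl⟩
  exact ⟨_, F.fromFock_fockAction_vacuum x⟩

theorem fromFock_injective (hG : (gram (oneParticle q m) q).PosDef) :
    Function.Injective F.fromFock := by
  rw [← LinearMap.ker_eq_bot]
  -- The kernel is annihilator-stable because the map intertwines the actions, and it misses the
  -- vacuum because `F.vac` is nonzero.
  refine eq_bot_of_ann_stable hG _ (fun i p hp => ?_) fun h => ?_
  · rw [LinearMap.mem_ker] at hp ⊢
    have h1 : F.rep (crePoly q m p) F.vac = 0 := congrArg Subtype.val hp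
    refine Subtype.ext ?_
    change F.rep (crePoly q m _) F.vac = 0
    rw [← fockAction_a, state_crePoly, h1, map_zero]
  · have h1 : F.rep (crePoly q m vacuum) F.vac = 0 := congrArg Subtype.val h
    refine F.vac_ne_zero ?_
    simpa [crePoly_vacuum] using h1

end FockRep

/-- A real vector space with a positive definite symmetric form embeds densely and isometrically
in a Hilbert space. -/
theorem exists_hilbert_completion {W : Type u} [AddCommGroup W] [Module ℝ W]
    (B : LinearMap.BilinForm ℝ W) (hs : ∀ u v, B u v = B v u) (hp : ∀ u, u ≠ 0 → 0 < B u u) :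
    ∃ (E : Type u) (_ : NormedAddCommGroup E) (_ : InnerProductSpace ℝ E) (_ : CompleteSpace E)
      (ι : W →ₗ[ℝ] E), DenseRange ι ∧ ∀ u v, inner ℝ (ι u) (ι v) = B u v := by
  let core : InnerProductSpace.Core ℝ W :=
    { inner := fun u v => B u v
      conj_inner_symm := fun u v => by simpa using hs v u
      re_inner_nonneg := fun u => by
        rcases eq_or_ne u 0 with rfl | h
        · simp
        · exact (hp u h).le
      add_left := fun u v w => by simp
      smul_left := fun u v r => by simp
      definite := fun u h => by
        by_contra h0
        exact (hp u h0).ne' h }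
  let _ : NormedAddCommGroup W := core.toNormedAddCommGroup
  let _ : InnerProductSpace ℝ W := InnerProductSpace.ofCore core.toCore
  refine ⟨UniformSpace.Completion W, inferInstance, inferInstance, inferInstance,
    (UniformSpace.Completion.toComplₗᵢ (𝕜 := ℝ) (E := W)).toLinearMap,
    UniformSpace.Completion.denseRange_coe, fun u v => ?_⟩
  exact UniformSpace.Completion.inner_coe u v

end Representation

end Quon

theorem theorem1 (m : ℕ) (q : ℝ)
    (hq : (m = 1 ∧ -1 < q ∧ q < 1) ∨ (1 < m ∧ 1 / (1 - (m : ℝ)) < q ∧ q < 1)) :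
    -- the vacuum expectation `x ↦ ⟨0| x |0⟩` exists and is unique
    (∃! ω : Quon.Alg q m →ₗ[ℝ] ℝ, Quon.IsVacuumExpectation ω) ∧
    -- the model is realizable: there is a Fock-like representation
    (∃ (V : Type) (_ : AddCommGroup V) (_ : Module ℝ V), Nonempty (Quon.FockRep q m V)) ∧
    -- on the space of states of every Fock-like representation, the form is a well-defined
    -- inner product, and its completion is a Hilbert space
    ∀ ω : Quon.Alg q m →ₗ[ℝ] ℝ, Quon.IsVacuumExpectation ω →
      ∀ (V : Type u) [AddCommGroup V] [Module ℝ V] (F : Quon.FockRep q m V),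
        ∃ B : LinearMap.BilinForm ℝ F.H,
          (∀ x y : Quon.Alg q m, B (F.state x) (F.state y) = ω (star x * y)) ∧
          (∀ u v : F.H, B u v = B v u) ∧
          (∀ u : F.H, u ≠ 0 → 0 < B u u) ∧
          ∃ (E : Type u) (_ : NormedAddCommGroup E) (_ : InnerProductSpace ℝ E)
            (_ : CompleteSpace E) (ι : F.H →ₗ[ℝ] E),
            DenseRange ι ∧ ∀ u v : F.H, inner ℝ (ι u) (ι v) = B u v := by
  have hG := Quon.gram_oneParticle_posDef hq
  refine ⟨⟨_, Quon.vacuumExpectation_isVacuumExpectation, fun ω hω => hω.eq⟩,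
    ⟨_, _, _, ⟨Quon.fockRep q m⟩⟩, fun ω hω V _ _ F => ?_⟩
  let e : Quon.Fock (ℕ+ × Fin m) ≃ₗ[ℝ] F.H :=
    LinearEquiv.ofBijective F.fromFock ⟨F.fromFock_injective hG, F.fromFock_surjective⟩
  have he : ∀ x, e.symm (F.state x) = Quon.fockAction q m x Quon.Fock.vacuum := fun x => by
    rw [LinearEquiv.symm_apply_eq]
    exact (F.fromFock_fockAction_vacuum x).symm
  -- Transport along `e` makes the form well defined: a state determines its Fock vector.
  let B : LinearMap.BilinForm ℝ F.H :=
    (Quon.Fock.form (Quon.oneParticle q m) q).compl₁₂ e.symm.toLinearMap e.symm.toLinearMap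
  have hs : ∀ u v, B u v = B v u := fun u v => Quon.Fock.form_symm hG _ _
  have hp : ∀ u, u ≠ 0 → 0 < B u u := fun u hu =>
    Quon.Fock.form_pos hG (e.symm.map_ne_zero_iff.2 hu)
  refine ⟨B, fun x y => ?_, hs, hp, Quon.exists_hilbert_completion B hs hp⟩
  change Quon.Fock.form _ q (e.symm (F.state x)) (e.symm (F.state y)) = _
  rw [he, he, Quon.form_fockAction_vacuum hG, hω.eq]
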